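/- Consider a sequence of queueing systems indexed by $n$. The $n$-th system has $n$ parallel servers of $M$ types, $N_j^{(n)}$ of type $j$ ($\sum_{j=1}^M N_j^{(n)}=n$), each with its own first-come-first-served queue of infinite capacity. Jobs arrive according to a Poisson process of rate $n\lambda^{(n)}$, where $0\le\lambda^{(n)}<1$; the service time of a job at a server of type $j$ is exponential with rate $\mu_j$, where $\mu_1>\mu_2>\dots>\mu_M>0$. An arriving job is sent to a server with the minimum queue length among all servers; ties between types are broken in favour of the fastest type, and ties within a type uniformly at random (the SA-JSQ policy). Thus the vector of queue lengths is a càdlàg continuous-time Markov chain with the corresponding transition rates; its initial state may be random. Let $Q^{(n)}_{j,1}(t)$ be the number of busy servers of type $j$ at time $t$, and put $$Y^{(n)}_{[1,M-1],1}(t)=\sum_{j=1}^{M-1}\frac{Q^{(n)}_{j,1}(t)-N_j^{(n)}}{\sqrt n}.$$ Assume that, for constants $\beta>0$ and $\gamma_j>0$ ($1\le j\le M$) with $\sum_{j=1}^M\mu_j\gamma_j=1$, $$\text{(A1)}\quad \lim_{n\to\infty}\sqrt n\,(1-\lambda^{(n)})=\beta,\qquad \text{(A2)}\quad \lim_{n\to\infty}\sqrt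 n\,\Bigl|\frac{N_j^{(n)}}{n}-\gamma_j\Bigr|=0\quad(1\le j\le M).$$ (i) If $Y^{(n)}_{[1,M-1],1}(0)$ converges weakly, as $n\to\infty$, to a (proper) real-valued random variable, then for every $\varepsilon>0$ and all $0<t_0\le T$, $$\lim_{n\to\infty}\mathbb P\Bigl(\sup_{s\in[t_0,T]}\bigl|Y^{(n)}_{[1,M-1],1}(s)\bigr|>\varepsilon\Bigr)=0.$$ (ii) If $Y^{(n)}_{[1,M-1],1}(0)$ converges weakly to $0$, then the same limit holds with $t_0=0$: for every $\varepsilon>0$ and $T\ge 0$, $\lim_{n\to\infty}\mathbb P\bigl(\sup_{s\in[0,T]}|Y^{(n)}_{[1,M-1],1}(s)|>\varepsilon\bigr)=0$. -/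

import Mathlib

open MeasureTheory ProbabilityTheory Filter Topology
open scoped NNReal

noncomputable section

namespace SAJSQ

/-! ### Càdlàg Markov processes given by a generator -/

section Generator

variable {Ω E : Type*}

/-- All sample paths of `X` are right-continuous with left limits. -/
def IsCadlagProcess [TopologicalSpace E] (X : ℝ≥0 → Ω → E) : Prop :=
  ∀ ω, ∀ t : ℝ≥0,
    ContinuousWithinAt (fun s => X s ω) (Set.Ici t) t ∧
      ∃ l : E, Tendsto (fun s => X s ω) (𝓝[<] t) (𝓝 l)

/-- Dynkin's process `f (X t) - f (X 0) - ∫₀ᵗ (G f)(X s) ds`. -/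
def dynkin (G : (E → ℝ) → E → ℝ) (X : ℝ≥0 → Ω → E) (f : E → ℝ) (t : ℝ≥0) (ω : Ω) : ℝ :=
  f (X t ω) - f (X 0 ω) - ∫ s in (0 : ℝ)..(t : ℝ), G f (X s.toNNReal ω)

/-- `X` is a càdlàg Markov process with generator `G`: it solves the martingale problem for `G`
(with all bounded functions as test functions), from its own initial law.  For the generator of a
continuous-time Markov chain with bounded jump rates on a countable discrete space, which is the
only case used below, this determines the law of `X` from the law of `X 0`. -/
structure IsMarkovWithGenerator [TopologicalSpace E] [MeasurableSpace E]
    {mΩ : MeasurableSpace Ω} (P : Measure Ω) (G : (E → ℝ) → E → ℝ) (X : ℝ≥0 → Ω → E) : Prop where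
  cadlag : IsCadlagProcess X
  martingale : ∃ ℱ : Filtration ℝ≥0 mΩ, Adapted ℱ X ∧
    ∀ f : E → ℝ, (∃ C : ℝ, ∀ x, |f x| ≤ C) → Martingale (dynkin G X f) ℱ P

end Generator

/-! ### The queueing system under the speed-aware join-the-shortest-queue policy -/

section System

variable {M : ℕ}

/-- The servers of a system with `N j` servers of type `j`. -/
abbrev Server (N : Fin M → ℕ) : Type := Σ j : Fin M, Fin (N j)

/-- A state of the system: the number of jobs (in service or waiting) at every server. -/
abbrev State (N : Fin M → ℕ) : Type := Server N → ℕ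

/-- The servers to which an arriving job may be sent in state `x`: those with the minimum queue
length among all servers and, among these, those with the maximum speed. -/
def targets (μ : Fin M → ℝ) {N : Fin M → ℕ} (x : State N) : Set (Server N) :=
  {k | (∀ l, x k ≤ x l) ∧ ∀ l, (∀ l', x l ≤ x l') → μ l.1 ≤ μ k.1}

open scoped Classical in
/-- The generator of the vector of queue lengths: jobs arrive at rate `a` (Poisson arrivals) and
are sent to a uniformly chosen server in `targets μ x`; a busy server of type `j` completes
services at rate `μ j` (exponential service times). -/
def generator (a : ℝ) (μ : Fin M → ℝ) (N : Fin M → ℕ) (f : State N → ℝ) (x : State N) : ℝ :=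
  (∑ k : Server N, if k ∈ targets μ x then
      a / ((targets μ x).ncard : ℝ) * (f (Function.update x k (x k + 1)) - f x) else 0) +
  ∑ k : Server N, if 0 < x k then
      μ k.1 * (f (Function.update x k (x k - 1)) - f x) else 0

/-- `X` is the process of queue lengths of the SA-JSQ system with total arrival rate `a`,
service rates `μ` and `N j` servers of type `j`, with an arbitrary (random) initial state. -/
def IsSAJSQ {Ω : Type*} {mΩ : MeasurableSpace Ω} (P : Measure Ω) (a : ℝ) (μ : Fin M → ℝ)
    (N : Fin M → ℕ) (X : ℝ≥0 → Ω → State N) : Prop :=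
  IsMarkovWithGenerator P (generator a μ N) X

/-- `Q_{j,i}`: the number of servers of type `j` with at least `i` jobs. -/
def occupancy {N : Fin M → ℕ} (x : State N) (j : Fin M) (i : ℕ) : ℕ :=
  Set.ncard {k : Fin (N j) | i ≤ x ⟨j, k⟩}

/-- The diffusion-scaled occupancy `Y_{j,i}`, `i ≥ 1`, of the `n`-th system:
`(Q_{j,1} - N j) / √n` for `i = 1`, and `Q_{j,i} / √n` for `i ≥ 2`. -/
def scaled (n : ℕ) {N : Fin M → ℕ} (x : State N) (j : Fin M) (i : ℕ) : ℝ :=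
  if i = 1 then ((occupancy x j 1 : ℝ) - (N j : ℝ)) / √(n : ℝ)
  else (occupancy x j i : ℝ) / √(n : ℝ)

/-- `Y_{[j₁,j₂],i} = ∑_{j=j₁}^{j₂} Y_{j,i}`.  Types are numbered `1, …, M` here: the element
`j` of `Fin M` is type number `j + 1`. -/
def scaledBlock (n : ℕ) {N : Fin M → ℕ} (x : State N) (j₁ j₂ i : ℕ) : ℝ :=
  ∑ j : Fin M with j₁ ≤ j.val + 1 ∧ j.val + 1 ≤ j₂, scaled n x j i

end System

end SAJSQ

end

/-! Let I be the number of idle servers of all types but the slowest; the scaled block equals -I/√n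
(`scaledBlock_eq`). While I > 0, every arrival goes to such a server, so I falls at rate nλ ≈ n. It
rises only when a faster server empties, at rate at most ∑ μ_j N_j ≈ nS over the faster types, where
S < 1 because the slowest type holds a positive share of the capacity. Hence I has drift of order
-n, while only values of order √n have to be excluded.

This is quantified by V = z^I with z slightly above 1: the generator satisfies G V ≤ -cn V + Cn
(`generator_lyapunov_le`, `exists_drift`). Two consequences follow. Decay: on {I(0) ≤ L√n}, E V(t) ≤
e^{-cnt} z^{L√n} + C/c, which is bounded for fixed t > 0, so P(I(t) > δ√n) → 0. The complement is
controlled by tightness of the initial values. Confinement: V can gain at most CnT on average, so by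
Doob's inequality a path starting below z^{δ√n} reaches z^{2δ√n} before T with vanishing
probability. For (i) decay reaches time t₀ and confinement covers [t₀, T]; for (ii) confinement
starts at time 0. -/

namespace SAJSQ

/-! ### Dynkin's formula and exponential decay of Lyapunov functions -/

section Abstract

variable {Ω E : Type*} {mΩ : MeasurableSpace Ω}

/-- A right-continuous real function is Borel measurable. -/
lemma measurable_of_rightContinuous {φ : ℝ → ℝ}
    (h : ∀ s, ContinuousWithinAt φ (Set.Ici s) s) : Measurable φ := by
  -- These grid points lie to the right of `s` and tend to it, so `φ` is a pointwise limit of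
  -- functions that factor through a floor.
  have key : ∀ s : ℝ, Tendsto (fun n : ℕ => ((⌊((n : ℝ) + 1) * s⌋ : ℝ) + 1) / ((n : ℝ) + 1))
      atTop (𝓝[≥] s) := by
    intro s
    have hlow : ∀ n : ℕ, s ≤ ((⌊((n : ℝ) + 1) * s⌋ : ℝ) + 1) / ((n : ℝ) + 1) := by
      intro n
      rw [le_div_iff₀ (by positivity)]
      linarith [Int.lt_floor_add_one (((n : ℝ) + 1) * s)]
    have hup : ∀ n : ℕ, ((⌊((n : ℝ) + 1) * s⌋ : ℝ) + 1) / ((n : ℝ) + 1) ≤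
        s + 1 / ((n : ℝ) + 1) := by
      intro n
      have hn : (0 : ℝ) < (n : ℝ) + 1 := by positivity
      rw [add_div]
      gcongr
      rw [div_le_iff₀ hn]
      linarith [Int.floor_le (((n : ℝ) + 1) * s)]
    refine tendsto_nhdsWithin_iff.2 ⟨?_, Eventually.of_forall hlow⟩
    refine tendsto_of_tendsto_of_tendsto_of_le_of_le tendsto_const_nhds ?_ hlow hup
    simpa using tendsto_const_nhds.add (tendsto_one_div_add_atTop_nhds_zero_nat (𝕜 := ℝ))
  refine measurable_of_tendsto_metrizable
    (f := fun n : ℕ => fun s : ℝ => φ (((⌊((n : ℝ) + 1) * s⌋ : ℝ) + 1) / ((n : ℝ) + 1))) ?_ ?_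
  · intro n
    have h1 : Measurable (fun s : ℝ => ⌊((n : ℝ) + 1) * s⌋) :=
      Int.measurable_floor.comp (measurable_const_mul _)
    exact (Measurable.of_discrete (f := fun m : ℤ => φ (((m : ℝ) + 1) / ((n : ℝ) + 1)))).comp h1
  · rw [tendsto_pi_nhds]
    exact fun s => (h s).tendsto.comp (key s)

variable [TopologicalSpace E] [DiscreteTopology E] {X : ℝ≥0 → Ω → E}

lemma IsCadlagProcess.eventually_eq (h : IsCadlagProcess X) (ω : Ω) (t : ℝ≥0) :
    ∃ η : ℝ, 0 < η ∧ ∀ u : ℝ≥0, t ≤ u → (u : ℝ) < t + η → X u ω = X t ω := by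
  have h1 : ∀ᶠ u in 𝓝[≥] t, X u ω = X t ω := by
    have := (h ω t).1
    rw [ContinuousWithinAt, nhds_discrete, tendsto_pure] at this
    exact this
  rw [eventually_nhdsWithin_iff, Metric.eventually_nhds_iff] at h1
  obtain ⟨η, hη, h1⟩ := h1
  refine ⟨η, hη, fun u hu hu' => h1 ?_ hu⟩
  rw [NNReal.dist_eq, abs_of_nonneg (sub_nonneg.2 (by exact_mod_cast hu))]
  linarith

lemma IsCadlagProcess.measurable_path (h : IsCadlagProcess X) (g : E → ℝ) (ω : Ω) :
    Measurable (fun s : ℝ => g (X s.toNNReal ω)) := by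
  refine measurable_of_rightContinuous fun s => ?_
  obtain ⟨η, hη, h1⟩ := h.eventually_eq ω s.toNNReal
  refine (continuousWithinAt_const (b := g (X s.toNNReal ω))).congr_of_eventuallyEq ?_ rfl
  filter_upwards [self_mem_nhdsWithin, mem_nhdsWithin_of_mem_nhds (Iio_mem_nhds
    (show s < s + η by linarith))] with u hu hu'
  have hu : s ≤ u := hu
  have hu' : u < s + η := hu'
  rw [h1 _ (Real.toNNReal_le_toNNReal hu)]
  rw [Real.coe_toNNReal', Real.coe_toNNReal']
  rcases le_total 0 u with h0 | h0
  · rw [max_eq_left h0]; linarith [le_max_left s 0]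
  · rw [max_eq_right h0]; linarith [le_max_right s 0]

lemma IsCadlagProcess.intervalIntegrable (h : IsCadlagProcess X) {g : E → ℝ} {D : ℝ}
    (hg : ∀ x, |g x| ≤ D) (ω : Ω) (a b : ℝ) :
    IntervalIntegrable (fun s : ℝ => g (X s.toNNReal ω)) volume a b := by
  refine (intervalIntegrable_const (c := D)).mono_fun
    (h.measurable_path g ω).aestronglyMeasurable (Eventually.of_forall fun s => ?_)
  simpa using (hg (X s.toNNReal ω)).trans (le_abs_self D)

lemma dynkin_sub {G : (E → ℝ) → E → ℝ} (h : IsCadlagProcess X) {f : E → ℝ} {D : ℝ}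
    (hG : ∀ x, |G f x| ≤ D) (s t : ℝ≥0) (ω : Ω) :
    dynkin G X f t ω - dynkin G X f s ω =
      f (X t ω) - f (X s ω) - ∫ u in (s : ℝ)..t, G f (X u.toNNReal ω) := by
  have := intervalIntegral.integral_interval_sub_left (h.intervalIntegrable hG ω 0 t)
    (h.intervalIntegrable hG ω 0 s)
  simp only [dynkin]
  linarith

lemma integral_path_le {h : E → ℝ} (hc : IsCadlagProcess X) {C D : ℝ} (hD : ∀ x, |h x| ≤ D)
    (hC : ∀ x, h x ≤ C) {s t : ℝ≥0} (hst : s ≤ t) (ω : Ω) :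
    ∫ u in (s : ℝ)..t, h (X u.toNNReal ω) ≤ C * (t - s) := by
  have := intervalIntegral.integral_mono_on (μ := volume) (g := fun _ => C)
    (NNReal.coe_le_coe.2 hst) (hc.intervalIntegrable hD ω s t) (by simp) (fun u _ => hC _)
  simpa [mul_comm] using this

variable [MeasurableSpace E] [DiscreteMeasurableSpace E] {P : Measure Ω} [IsProbabilityMeasure P]
  {G : (E → ℝ) → E → ℝ} {ℱ : Filtration ℝ≥0 mΩ}

omit [TopologicalSpace E] [DiscreteTopology E] in
lemma integrable_comp (hX : Adapted ℱ X) {f : E → ℝ} {B : ℝ} (hf : ∀ x, |f x| ≤ B) (t : ℝ≥0) :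
    Integrable (fun ω => f (X t ω)) P := by
  refine Integrable.of_bound (C := B) ?_ (Eventually.of_forall fun ω => hf _)
  exact (Measurable.of_discrete.comp ((hX t).mono (ℱ.le t) le_rfl)).aestronglyMeasurable

/-- The time integral is an increment of `f (X ·)` minus an increment of the Dynkin martingale, so
its measurability in `ω` needs no joint measurability of the process. -/
lemma integrable_path (hc : IsCadlagProcess X) (hX : Adapted ℱ X) {f : E → ℝ} {B D : ℝ}
    (hf : ∀ x, |f x| ≤ B) (hG : ∀ x, |G f x| ≤ D) (hM : Martingale (dynkin G X f) ℱ P)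
    (s t : ℝ≥0) : Integrable (fun ω => ∫ u in (s : ℝ)..t, G f (X u.toNNReal ω)) P := by
  have h1 := ((integrable_comp (P := P) hX hf t).sub (integrable_comp hX hf s)).sub
    ((hM.integrable t).sub (hM.integrable s))
  refine h1.congr (Eventually.of_forall fun ω => ?_)
  have := dynkin_sub hc hG s t ω
  simp only [Pi.sub_apply]
  linarith

/-- Dynkin's formula on an event of the past. -/
lemma setIntegral_dynkin (hc : IsCadlagProcess X) (hX : Adapted ℱ X) {f : E → ℝ} {B D : ℝ}
    (hf : ∀ x, |f x| ≤ B) (hG : ∀ x, |G f x| ≤ D) (hM : Martingale (dynkin G X f) ℱ P)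
    {s t : ℝ≥0} (hst : s ≤ t) {A : Set Ω} (hA : MeasurableSet[ℱ s] A) :
    ∫ ω in A, f (X t ω) ∂P - ∫ ω in A, f (X s ω) ∂P =
      ∫ ω in A, (∫ u in (s : ℝ)..t, G f (X u.toNNReal ω)) ∂P := by
  have h0 := hM.setIntegral_eq hst hA
  have h1 : ∫ ω in A, (dynkin G X f t ω - dynkin G X f s ω) ∂P = 0 := by
    rw [integral_sub (hM.integrable t).integrableOn (hM.integrable s).integrableOn, h0, sub_self]
  simp only [dynkin_sub hc hG s t] at h1
  have i1 : Integrable (fun ω => f (X t ω)) (P.restrict A) := (integrable_comp hX hf t).integrableOn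
  have i2 : Integrable (fun ω => f (X s ω)) (P.restrict A) := (integrable_comp hX hf s).integrableOn
  rw [integral_sub (f := fun ω => f (X t ω) - f (X s ω)) (i1.sub i2) (integrable_path hc hX hf hG hM s t).integrableOn,
    integral_sub i1 i2] at h1
  linarith

/-- Exponential decay of a Lyapunov function, on an event of the past. -/
lemma setIntegral_le_of_generator_le (hc : IsCadlagProcess X) (hX : Adapted ℱ X) {f : E → ℝ}
    {B D : ℝ} (hf : ∀ x, |f x| ≤ B) (hG : ∀ x, |G f x| ≤ D)
    (hM : Martingale (dynkin G X f) ℱ P) {c C : ℝ} (hc0 : 0 < c) (hC : 0 ≤ C)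
    (hle : ∀ x, G f x ≤ -c * f x + C) (t : ℝ≥0) {A : Set Ω} (hA : MeasurableSet[ℱ 0] A) :
    ∫ ω in A, f (X t ω) ∂P ≤ Real.exp (-c * t) * ∫ ω in A, f (X 0 ω) ∂P + C / c := by
  set φ : ℝ → ℝ := fun s => ∫ ω in A, f (X s.toNNReal ω) ∂P with hφ
  have hA' : ∀ s, MeasurableSet[ℱ s] A := fun s => ℱ.mono zero_le _ hA
  have hd : ∀ x y : ℝ, 0 ≤ x → x ≤ y → φ y - φ x =
      ∫ ω in A, (∫ u in x..y, G f (X u.toNNReal ω)) ∂P := by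
    intro x y hx hxy
    have := setIntegral_dynkin hc hX hf hG hM (Real.toNNReal_le_toNNReal hxy) (hA' x.toNNReal)
    simpa [hx, hx.trans hxy] using this
  have hD0 : 0 ≤ D := by
    obtain ⟨ω⟩ : Nonempty Ω := nonempty_of_isProbabilityMeasure P
    exact (abs_nonneg _).trans (hG (X 0 ω))
  have hJ : ∀ x y : ℝ, x ≤ y → ∀ ω, |∫ u in x..y, G f (X u.toNNReal ω)| ≤ D * (y - x) := by
    intro x y hxy ω
    have := intervalIntegral.norm_integral_le_of_norm_le_const (a := x) (b := y) (C := D)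
      (f := fun u => G f (X u.toNNReal ω)) (fun u _ => hG _)
    rwa [abs_of_nonneg (sub_nonneg.2 hxy)] at this
  have hlip : ∀ x y : ℝ, 0 ≤ x → x ≤ y → |φ y - φ x| ≤ D * (y - x) := by
    intro x y hx hxy
    rw [hd x y hx hxy]
    have := norm_setIntegral_le_of_norm_le_const (μ := P) (s := A)
      (f := fun ω => ∫ u in x..y, G f (X u.toNNReal ω)) (C := D * (y - x))
      (measure_lt_top _ _) (fun ω _ => hJ x y hxy ω)
    refine this.trans ?_
    exact mul_le_of_le_one_right (mul_nonneg hD0 (sub_nonneg.2 hxy)) measureReal_le_one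
  have hcont : ContinuousOn φ (Set.Icc 0 (t : ℝ)) := by
    refine LipschitzOnWith.continuousOn (K := D.toNNReal) (LipschitzOnWith.of_dist_le_mul ?_)
    intro x hx y hy
    rw [Real.coe_toNNReal _ hD0]
    rcases le_total x y with h | h
    · rw [dist_comm, dist_comm x, Real.dist_eq, Real.dist_eq, abs_of_nonneg (sub_nonneg.2 h)]
      exact hlip x y hx.1 h
    · rw [Real.dist_eq, Real.dist_eq, abs_of_nonneg (sub_nonneg.2 h)]
      exact hlip y x hy.1 h
  -- Paths are constant just after `x`, so the averaged time integral converges pointwise; the bound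
  -- `D` dominates. A right derivative is all that Grönwall's inequality requires.
  have hder : ∀ x ∈ Set.Ico 0 (t : ℝ), Tendsto (fun z => (z - x)⁻¹ * (φ z - φ x)) (𝓝[>] x)
      (𝓝 (∫ ω in A, G f (X x.toNNReal ω) ∂P)) := by
    intro x hx
    have hev : (fun z => (z - x)⁻¹ * (φ z - φ x)) =ᶠ[𝓝[>] x]
        fun z => ∫ ω in A, ((z - x)⁻¹ * ∫ u in x..z, G f (X u.toNNReal ω)) ∂P := by
      filter_upwards [self_mem_nhdsWithin] with z hz
      rw [integral_const_mul, hd x z hx.1 (le_of_lt hz)]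
    refine Tendsto.congr' hev.symm ?_
    refine tendsto_integral_filter_of_dominated_convergence (fun _ => D) ?_ ?_ (by simp) ?_
    · filter_upwards [self_mem_nhdsWithin] with z hz
      have hz : x < z := hz
      have := (integrable_path (P := P) hc hX hf hG hM x.toNNReal z.toNNReal).integrableOn (s := A)
      rw [Real.coe_toNNReal _ hx.1, Real.coe_toNNReal _ (hx.1.trans hz.le)] at this
      exact this.aestronglyMeasurable.const_mul _
    · filter_upwards [self_mem_nhdsWithin] with z hz
      have hz : x < z := hz
      refine Eventually.of_forall fun ω => ?_
      have h0 : 0 < z - x := sub_pos.2 hz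
      rw [norm_mul, norm_inv, Real.norm_of_nonneg h0.le, inv_mul_le_iff₀ h0, mul_comm]
      exact hJ x z hz.le ω
    · refine Eventually.of_forall fun ω => tendsto_const_nhds.congr' ?_
      obtain ⟨η, hη, h1⟩ := hc.eventually_eq ω x.toNNReal
      filter_upwards [self_mem_nhdsWithin, mem_nhdsWithin_of_mem_nhds (Iio_mem_nhds
        (show x < x + η by linarith))] with z hz hz'
      have hz : x < z := hz
      have hz' : z < x + η := hz'
      have : ∫ u in x..z, G f (X u.toNNReal ω) = ∫ u in x..z, G f (X x.toNNReal ω) := by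
        refine intervalIntegral.integral_congr fun u hu => ?_
        rw [Set.uIcc_of_le hz.le] at hu
        rw [h1 _ (Real.toNNReal_le_toNNReal hu.1)]
        rw [Real.coe_toNNReal _ hx.1, Real.coe_toNNReal _ (hx.1.trans hu.1)]
        linarith [hu.2]
      rw [this, intervalIntegral.integral_const, smul_eq_mul, inv_mul_cancel_left₀]
      linarith
  have hb : ∀ x ∈ Set.Ico 0 (t : ℝ), ∫ ω in A, G f (X x.toNNReal ω) ∂P ≤ -c * φ x + C := by
    intro x _
    have hi : Integrable (fun ω => f (X x.toNNReal ω)) (P.restrict A) :=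
      (integrable_comp hX hf _).integrableOn
    have h1 : ∫ ω in A, G f (X x.toNNReal ω) ∂P ≤ ∫ ω in A, (-c * f (X x.toNNReal ω) + C) ∂P :=
      integral_mono (integrable_comp hX hG _).integrableOn
        ((hi.const_mul _).add (integrable_const _)) fun ω => hle _
    rw [integral_add (hi.const_mul _) (integrable_const _), integral_const_mul] at h1
    refine h1.trans (add_le_add le_rfl ?_)
    simpa using mul_le_of_le_one_left hC (measureReal_le_one (μ := P) (s := A))
  have := le_gronwallBound_of_liminf_deriv_right_le hcont
    (fun x hx r hr => ((hder x hx).eventually_lt_const hr).frequently) le_rfl hb t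
    ⟨t.2, le_rfl⟩
  rw [gronwallBound_of_K_ne_0 (by linarith)] at this
  simp only [hφ, Real.toNNReal_coe, Real.toNNReal_zero, sub_zero] at this
  refine this.trans ?_
  rw [mul_comm (Real.exp _)]
  gcongr
  -- The remaining Grönwall term is `C / c * (1 - exp (-c * t))`.
  rw [div_neg, neg_mul, ← mul_neg, neg_sub]
  refine mul_le_of_le_one_right (by positivity) ?_
  linarith [Real.exp_pos (-c * t)]

end Abstract

/-! ### Maximal inequalities, from discrete grids to continuous time -/

section Maximal

variable {Ω : Type*} {mΩ : MeasurableSpace Ω} {P : Measure Ω} [IsProbabilityMeasure P]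
  {ℱ : Filtration ℝ≥0 mΩ}

/-- Increments of a martingale along a sequence of times, on an event of the past. -/
lemma martingale_increment {M : ℝ≥0 → Ω → ℝ} (hM : Martingale M ℱ P) {t : ℕ → ℝ≥0}
    (ht : Monotone t) {B : Set Ω} (hB : MeasurableSet[ℱ (t 0)] B) :
    Martingale (fun i => B.indicator (fun ω => M (t i) ω - M (t 0) ω))
      ⟨fun i => ℱ (t i), fun _ _ h => ℱ.mono (ht h), fun i => ℱ.le (t i)⟩ P := by
  have hBi : ∀ i, MeasurableSet[ℱ (t i)] B := fun i => ℱ.mono (ht (Nat.zero_le i)) _ hB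
  refine martingale_of_setIntegral_eq_succ (fun i => ?_) (fun i => ?_) fun i s hs => ?_
  · exact ((hM.stronglyMeasurable (t i)).sub ((hM.stronglyMeasurable (t 0)).mono
      (ℱ.mono (ht (Nat.zero_le i))))).indicator (hBi i)
  · exact ((hM.integrable _).sub (hM.integrable _)).indicator (ℱ.le _ _ hB)
  · have hs : MeasurableSet[ℱ (t i)] s := hs
    have hsB := hs.inter (hBi i)
    rw [setIntegral_indicator (ℱ.le _ _ hB), setIntegral_indicator (ℱ.le _ _ hB),
      integral_sub (hM.integrable _).integrableOn (hM.integrable _).integrableOn,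
      integral_sub (hM.integrable _).integrableOn (hM.integrable _).integrableOn,
      hM.setIntegral_eq (ht i.le_succ) hsB]

/-- Doob's maximal inequality for a martingale started from `0` and bounded below at the end. -/
lemma measure_exists_le_martingale {W : ℕ → Ω → ℝ} {𝒢 : Filtration ℕ mΩ} (hW : Martingale W 𝒢 P)
    (h0 : W 0 = 0) {n : ℕ} {K : ℝ} (hK : 0 ≤ K) (hlow : ∀ ω, -K ≤ W n ω) {a : ℝ} (ha : 0 < a) :
    P {ω | ∃ i ≤ n, a ≤ W i ω} ≤ ENNReal.ofReal (K / a) := by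
  have hsub := hW.submartingale.pos
  have hmax := maximal_ineq hsub (fun i ω => by simp) (ε := a.toNNReal) n
  have hsubset : {ω | ∃ i ≤ n, a ≤ W i ω} ⊆ {ω | (a.toNNReal : ℝ) ≤
      (Finset.range (n + 1)).sup' Finset.nonempty_range_add_one fun k => (W⁺) k ω} := by
    rintro ω ⟨i, hi, h⟩
    rw [Set.mem_ofPred_eq, Real.coe_toNNReal _ ha.le, Finset.le_sup'_iff]
    exact ⟨i, by simpa [Nat.lt_succ_iff] using hi, h.trans (le_posPart (W i ω))⟩
  have hint : ∫ ω, W n ω ∂P = 0 := by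
    have := hW.setIntegral_eq (Nat.zero_le n) MeasurableSet.univ
    simpa [h0] using this.symm
  -- Since W ≥ -K and K ≥ 0, the positive part is at most W + K, whose mean is K.
  have hpos : ∀ s, ∫ ω in s, (W⁺) n ω ∂P ≤ K := by
    intro s
    calc ∫ ω in s, (W⁺) n ω ∂P ≤ ∫ ω, (W⁺) n ω ∂P :=
          setIntegral_le_integral (hsub.integrable n)
            (Eventually.of_forall fun ω => posPart_nonneg (W n ω))
      _ ≤ ∫ ω, (W n ω + K) ∂P := by
          refine integral_mono (hsub.integrable n)
            ((hW.integrable n).add (integrable_const _)) fun ω => ?_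
          have : (W⁺) n ω = max (W n ω) 0 := rfl
          rw [this]
          refine max_le ?_ ?_ <;> linarith [hlow ω]
      _ = K := by
          rw [integral_add (hW.integrable n) (integrable_const _), hint]; simp
  have h1 : ENNReal.ofReal a * P {ω | ∃ i ≤ n, a ≤ W i ω} ≤ ENNReal.ofReal K :=
    (mul_le_mul_right (measure_mono hsubset) _).trans
      (hmax.trans (ENNReal.ofReal_le_ofReal (hpos _)))
  rw [ENNReal.ofReal_div_of_pos ha, ENNReal.le_div_iff_mul_le
    (Or.inl (by simpa using ha)) (Or.inl ENNReal.ofReal_ne_top), mul_comm]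
  exact h1

variable {E : Type*} [TopologicalSpace E] [DiscreteTopology E] [MeasurableSpace E]
  [DiscreteMeasurableSpace E] {X : ℝ≥0 → Ω → E} {G : (E → ℝ) → E → ℝ}

/-- On the starting event, the Dynkin martingale restarted at `t 0` is at least f - (r + CT). So it
stays above -(r + CT), and f can reach b only if the martingale reaches b - (r + CT). -/
lemma measure_exists_grid_le (hc : IsCadlagProcess X) (hX : Adapted ℱ X) {f : E → ℝ}
    {D : ℝ} (hf0 : ∀ x, 0 ≤ f x) (hG : ∀ x, |G f x| ≤ D)
    (hM : Martingale (dynkin G X f) ℱ P) {C : ℝ} (hC : 0 ≤ C) (hle : ∀ x, G f x ≤ C)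
    {t : ℕ → ℝ≥0} (ht : Monotone t) (n : ℕ) {T : ℝ} (hT : t n ≤ T) {r b : ℝ} (hr : 0 ≤ r)
    (hb : r + C * T < b) :
    P ({ω | f (X (t 0) ω) ≤ r} ∩ {ω | ∃ i ≤ n, b ≤ f (X (t i) ω)}) ≤
      ENNReal.ofReal ((r + C * T) / (b - (r + C * T))) := by
  have hT0 : 0 ≤ T := (t n).2.trans hT
  set B : Set Ω := {ω | f (X (t 0) ω) ≤ r} with hBdef
  have hB : MeasurableSet[ℱ (t 0)] B := hX (t 0) (MeasurableSet.of_discrete (s := {x | f x ≤ r}))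
  have hW := martingale_increment hM ht hB
  have hint : ∀ i ≤ n, ∀ ω, ∫ u in (t 0 : ℝ)..t i, G f (X u.toNNReal ω) ≤ C * T := by
    intro i hi ω
    refine (integral_path_le hc hG hle (ht (Nat.zero_le i)) ω).trans ?_
    have : (t i : ℝ) ≤ T := (NNReal.coe_le_coe.2 (ht hi)).trans hT
    have h0 : (0 : ℝ) ≤ t 0 := (t 0).2
    gcongr
    linarith
  refine (measure_mono ?_).trans (measure_exists_le_martingale hW ?_ (n := n) (K := r + C * T)
    (by positivity) ?_ (sub_pos.2 hb))
  · rintro ω ⟨hω, i, hi, h⟩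
    refine ⟨i, hi, ?_⟩
    simp only [Set.indicator_of_mem hω]
    rw [dynkin_sub hc hG]
    have h1 : f (X (t 0) ω) ≤ r := hω
    linarith [hint i hi ω]
  · ext ω; simp
  · intro ω
    by_cases hω : ω ∈ B
    · simp only [Set.indicator_of_mem hω]
      rw [dynkin_sub hc hG]
      have h1 : f (X (t 0) ω) ≤ r := hω
      linarith [hint n le_rfl ω, hf0 (X (t n) ω)]
    · simp only [Set.indicator_of_notMem hω]
      have : 0 ≤ r + C * T := by positivity
      linarith

omit [MeasurableSpace E] [DiscreteMeasurableSpace E] in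
/-- A right-continuous path that visits a set during `[s, s + h]` does so on a dyadic grid. -/
lemma exists_grid_eq (hc : IsCadlagProcess X) (ω : Ω) {s h u : ℝ≥0} (hu : s ≤ u)
    (hu' : u ≤ s + h) :
    ∃ k i : ℕ, i ≤ 2 ^ k ∧ X (s + i * (h / 2 ^ k)) ω = X u ω := by
  rcases eq_or_ne h 0 with rfl | hh
  · exact ⟨0, 0, by simp, by simp [le_antisymm hu (by simpa using hu')]⟩
  have hh : (0 : ℝ) < h := by exact_mod_cast pos_iff_ne_zero.2 hh
  obtain ⟨η, hη, h1⟩ := hc.eventually_eq ω u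
  obtain ⟨k, hk⟩ : ∃ k : ℕ, (h : ℝ) / 2 ^ k < η := by
    obtain ⟨k, hk⟩ := pow_unbounded_of_one_lt ((h : ℝ) / η) (one_lt_two (α := ℝ))
    refine ⟨k, ?_⟩
    rw [div_lt_iff₀ hη] at hk
    rw [div_lt_iff₀ (by positivity)]
    linarith
  have hd : 0 < (h : ℝ) / 2 ^ k := by positivity
  have hsu : (s : ℝ) ≤ u := by exact_mod_cast hu
  have hus : (u : ℝ) ≤ s + h := by exact_mod_cast hu'
  have hnn : 0 ≤ ((u : ℝ) - s) / (h / 2 ^ k) := div_nonneg (by linarith) hd.le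
  -- Rounding up places the grid point in [u, u + η), where the path still has its value at `u`.
  refine ⟨k, ⌈((u : ℝ) - s) / (h / 2 ^ k)⌉₊, ?_, h1 _ ?_ ?_⟩
  · rw [Nat.ceil_le, div_le_iff₀ hd]
    push_cast
    field_simp
    linarith
  · rw [← NNReal.coe_le_coe]
    push_cast
    have := Nat.le_ceil (((u : ℝ) - s) / (h / 2 ^ k))
    rw [div_le_iff₀ hd] at this
    linarith
  · push_cast
    have := Nat.ceil_lt_add_one hnn
    have h2 := mul_lt_mul_of_pos_right this hd
    rw [add_mul, div_mul_cancel₀ _ hd.ne'] at h2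
    linarith

/-- A maximal inequality in continuous time for a Lyapunov function. -/
lemma measure_exists_mem_Icc_le (hc : IsCadlagProcess X) (hX : Adapted ℱ X) {f : E → ℝ}
    {D : ℝ} (hf0 : ∀ x, 0 ≤ f x) (hG : ∀ x, |G f x| ≤ D)
    (hM : Martingale (dynkin G X f) ℱ P) {C : ℝ} (hC : 0 ≤ C) (hle : ∀ x, G f x ≤ C)
    {s T : ℝ≥0} (hsT : s ≤ T) {r b : ℝ} (hr : 0 ≤ r) (hb : r + C * T < b) :
    P {ω | ∃ u ∈ Set.Icc s T, b ≤ f (X u ω)} ≤ P {ω | r < f (X s ω)} +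
      ENNReal.ofReal ((r + C * T) / (b - (r + C * T))) := by
  set B : Set Ω := {ω | f (X s ω) ≤ r} with hBdef
  set t : ℕ → ℕ → ℝ≥0 := fun k i => s + i * ((T - s) / 2 ^ k) with ht
  set A : ℕ → Set Ω := fun k => B ∩ {ω | ∃ i ≤ 2 ^ k, b ≤ f (X (t k i) ω)} with hA
  -- Each dyadic grid contains the previous one, so the uniform bound on the grids passes to the
  -- union by continuity from below.
  have hAmono : Monotone A := by
    refine monotone_nat_of_le_succ fun k => Set.inter_subset_inter_right _ ?_
    rintro ω ⟨i, hi, h⟩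
    refine ⟨2 * i, by rw [pow_succ]; omega, ?_⟩
    have : t (k + 1) (2 * i) = t k i := by
      simp only [ht]
      push_cast
      rw [pow_succ]
      field_simp
    rwa [this]
  have hbound : ∀ k, P (A k) ≤ ENNReal.ofReal ((r + C * T) / (b - (r + C * T))) := by
    intro k
    have hmono : Monotone (t k) := fun i j hij => by
      simp only [ht]
      gcongr
    have h0 : t k 0 = s := by simp [ht]
    have hn : t k (2 ^ k) = T := by
      simp only [ht]
      push_cast
      rw [mul_div_cancel₀ _ (by positivity), add_tsub_cancel_of_le hsT]
    have := measure_exists_grid_le hc hX hf0 hG hM hC hle hmono (2 ^ k) (T := T)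
      (by rw [hn]) hr hb
    rwa [h0] at this
  have hsub : {ω | ∃ u ∈ Set.Icc s T, b ≤ f (X u ω)} ⊆ {ω | r < f (X s ω)} ∪ ⋃ k, A k := by
    rintro ω ⟨u, hu, h⟩
    by_cases hω : r < f (X s ω)
    · exact Or.inl hω
    · obtain ⟨k, i, hi, he⟩ := exists_grid_eq hc ω (h := T - s) hu.1
        (by rw [add_tsub_cancel_of_le hsT]; exact hu.2)
      exact Or.inr (Set.mem_iUnion.2 ⟨k, not_lt.1 hω, i, hi, by simpa only [ht, he] using h⟩)
  refine (measure_mono hsub).trans ((measure_union_le _ _).trans (add_le_add le_rfl ?_))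
  rw [hAmono.measure_iUnion]
  exact iSup_le hbound

end Maximal

/-! ### Idle fast servers and the drift of z^I -/

section Idle

variable {M : ℕ} {N : Fin M → ℕ}

/-- The server types other than the slowest one. -/
def fastTypes (M : ℕ) : Finset (Fin M) :=
  Finset.univ.filter fun j => 1 ≤ j.val + 1 ∧ j.val + 1 ≤ M - 1

/-- The idle servers of the types other than the slowest one. -/
def idleFast (x : State N) : Finset (Server N) :=
  Finset.univ.filter fun k => k.1 ∈ fastTypes M ∧ x k = 0

lemma mem_idleFast {x : State N} {k : Server N} :
    k ∈ idleFast x ↔ k.1 ∈ fastTypes M ∧ x k = 0 := by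
  simp [idleFast]

lemma scaledBlock_eq (n : ℕ) (x : State N) :
    scaledBlock n x 1 (M - 1) 1 = -((idleFast x).card : ℝ) / √(n : ℝ) := by
  have hocc : ∀ j, (occupancy x j 1 : ℝ) - N j =
      -((Finset.univ.filter fun i : Fin (N j) => x ⟨j, i⟩ = 0).card : ℝ) := by
    intro j
    have h1 : occupancy x j 1 =
        (Finset.univ.filter fun i : Fin (N j) => ¬ x ⟨j, i⟩ = 0).card := by
      rw [occupancy, ← Set.ncard_coe_finset]
      congr 1
      ext i
      simp [Nat.one_le_iff_ne_zero]
    have h2 := Finset.card_filter_add_card_filter_not (s := (Finset.univ : Finset (Fin (N j))))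
      (fun i => x ⟨j, i⟩ = 0)
    rw [← h1, Finset.card_fin] at h2
    have h3 : ((Finset.univ.filter fun i : Fin (N j) => x ⟨j, i⟩ = 0).card : ℝ) +
        occupancy x j 1 = N j := by exact_mod_cast h2
    linarith
  have hcard : (idleFast x).card =
      ∑ j ∈ fastTypes M, (Finset.univ.filter fun i : Fin (N j) => x ⟨j, i⟩ = 0).card := by
    rw [← Finset.card_sigma]
    congr 1
    ext ⟨j, i⟩
    simp [mem_idleFast]
  simp only [scaledBlock, scaled, ↓reduceIte, hocc]
  rw [← Finset.sum_div, Finset.sum_neg_distrib, hcard]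
  rw [Nat.cast_sum]
  rfl

lemma idleFast_update_succ (x : State N) (k : Server N) :
    idleFast (Function.update x k (x k + 1)) = (idleFast x).erase k := by
  ext l
  rw [Finset.mem_erase, mem_idleFast, mem_idleFast]
  rcases eq_or_ne l k with rfl | h
  · simp
  · simp [h]

/-- A departure can make only its own server idle, and this counts only if that server is of a
faster type. -/
lemma card_idleFast_update_pred_le (x : State N) (k : Server N) :
    (idleFast (Function.update x k (x k - 1))).card ≤
      (idleFast x).card + if k.1 ∈ fastTypes M then 1 else 0 := by
  split_ifs with hk
  · refine (Finset.card_le_card (t := insert k (idleFast x)) fun l hl => ?_).trans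
      (Finset.card_insert_le _ _)
    rw [Finset.mem_insert]
    by_cases h : l = k
    · exact Or.inl h
    · rw [mem_idleFast, Function.update_of_ne h] at hl
      exact Or.inr (mem_idleFast.2 hl)
  · refine Finset.card_le_card fun l hl => ?_
    rw [mem_idleFast] at hl
    have h : l ≠ k := fun h => hk (h ▸ hl.1)
    rw [Function.update_of_ne h] at hl
    exact mem_idleFast.2 hl

lemma lt_of_mem_fastTypes {i j : Fin M} (hi : i ∈ fastTypes M) (hj : j ∉ fastTypes M) : i < j := by
  simp only [fastTypes, Finset.mem_filter, Finset.mem_univ, true_and] at hi hj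
  rw [Fin.lt_def]
  omega

lemma targets_nonempty (μ : Fin M → ℝ) (x : State N) [Nonempty (Server N)] :
    (targets μ x).Nonempty := by
  obtain ⟨k₀, -, hk₀⟩ := Finset.exists_min_image Finset.univ x Finset.univ_nonempty
  obtain ⟨k, hk, hmax⟩ := Finset.exists_max_image
    (Finset.univ.filter fun k => ∀ l, x k ≤ x l) (fun k => μ k.1)
    ⟨k₀, by simpa using hk₀⟩
  exact ⟨k, by simpa using hk, fun l hl => hmax l (by simpa using hl)⟩

/-- An idle fast server makes the minimum queue length 0, so targets are idle; a target of the
slowest type would lose the tie to it. -/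
lemma targets_subset_idleFast {μ : Fin M → ℝ} (hμ : StrictAnti μ) {x : State N}
    (h : (idleFast x).Nonempty) {k : Server N} (hk : k ∈ targets μ x) : k ∈ idleFast x := by
  obtain ⟨l, hl⟩ := h
  obtain ⟨hl1, hl2⟩ := mem_idleFast.1 hl
  refine mem_idleFast.2 ⟨?_, Nat.le_zero.1 (hl2 ▸ hk.1 l)⟩
  by_contra hkf
  exact absurd (hk.2 l fun l' => by simp [hl2]) (not_le.2 (hμ (lt_of_mem_fastTypes hl1 hkf)))

/-- The Lyapunov function `z ^ (number of idle servers of the faster types)`. -/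
noncomputable def lyapunov (z : ℝ) (x : State N) : ℝ := z ^ (idleFast x).card

lemma abs_lyapunov_le {z : ℝ} (hz : 1 ≤ z) (x : State N) :
    |lyapunov z x| ≤ z ^ Fintype.card (Server N) := by
  rw [lyapunov, abs_of_nonneg (by positivity)]
  exact pow_le_pow_right₀ hz (Finset.card_le_univ _)

/-- A crude bound depending on the system size. It serves integrability only and does not enter the
quantitative estimates. -/
lemma abs_generator_le (a : ℝ) (μ : Fin M → ℝ) {f : State N → ℝ} {B : ℝ}
    (hf : ∀ x, |f x| ≤ B) (x : State N) :
    |generator a μ N f x| ≤ ∑ k : Server N, (|a| + |μ k.1|) * (2 * B) := by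
  have hB : 0 ≤ B := (abs_nonneg _).trans (hf x)
  have hd : ∀ y, |f y - f x| ≤ 2 * B := fun y =>
    (abs_sub _ _).trans (by linarith [hf y, hf x])
  simp only [add_mul]
  rw [Finset.sum_add_distrib]
  refine (abs_add_le _ _).trans (add_le_add ?_ ?_) <;>
    refine (Finset.abs_sum_le_sum_abs _ _).trans (Finset.sum_le_sum fun k _ => ?_)
  · split_ifs with hk
    · rw [abs_mul, abs_div]
      refine mul_le_mul ?_ (hd _) (abs_nonneg _) (abs_nonneg _)
      refine div_le_self (abs_nonneg _) ?_
      rw [Nat.abs_cast, Nat.one_le_cast]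
      exact (Set.ncard_pos (Set.toFinite _)).2 ⟨k, hk⟩
    · rw [abs_zero]; positivity
  · split_ifs with hk
    · rw [abs_mul]
      exact mul_le_mul_of_nonneg_left (hd _) (abs_nonneg _)
    · rw [abs_zero]; positivity

open scoped Classical in
lemma arrival_lyapunov_nonpos {a : ℝ} (ha : 0 ≤ a) (μ : Fin M → ℝ) {z : ℝ} (hz : 1 ≤ z)
    (x : State N) :
    (∑ k : Server N, if k ∈ targets μ x then
      a / ((targets μ x).ncard : ℝ) *
        (lyapunov z (Function.update x k (x k + 1)) - lyapunov z x) else 0) ≤ 0 := by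
  refine Finset.sum_nonpos fun k _ => ?_
  split_ifs
  · refine mul_nonpos_of_nonneg_of_nonpos (by positivity) (sub_nonpos.2 ?_)
    rw [lyapunov, lyapunov, idleFast_update_succ]
    exact pow_le_pow_right₀ hz (Finset.card_le_card (Finset.erase_subset _ _))
  · exact le_rfl

-- Each possible target is an idle fast server, so an arrival divides z^I by z, and the routing
-- rates add up to `a`.
open scoped Classical in
lemma arrival_lyapunov_eq (a : ℝ) {μ : Fin M → ℝ} (hμ : StrictAnti μ) {z : ℝ} (hz : 1 ≤ z)
    {x : State N} (h : (idleFast x).Nonempty) :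
    (∑ k : Server N, if k ∈ targets μ x then
      a / ((targets μ x).ncard : ℝ) *
        (lyapunov z (Function.update x k (x k + 1)) - lyapunov z x) else 0) =
      lyapunov z x * ((z - 1) * -(a / z)) := by
  have hterm : ∀ k ∈ targets μ x, lyapunov z (Function.update x k (x k + 1)) - lyapunov z x =
      -(lyapunov z x * (z - 1) / z) := by
    intro k hk
    have hk' := targets_subset_idleFast hμ h hk
    obtain ⟨m, hm⟩ := Nat.exists_eq_succ_of_ne_zero (Finset.card_ne_zero.2 h)
    rw [lyapunov, lyapunov, idleFast_update_succ, Finset.card_erase_of_mem hk', hm]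
    have : z ≠ 0 := by linarith
    field_simp
    simp
    ring
  obtain ⟨k₀, -⟩ := h
  have : Nonempty (Server N) := ⟨k₀⟩
  have hpos : (0 : ℝ) < (targets μ x).ncard := by
    exact_mod_cast (Set.ncard_pos (Set.toFinite _)).2 (targets_nonempty μ x)
  rw [← Finset.sum_filter, Finset.sum_congr rfl fun k hk => by
    rw [hterm k (by simpa using hk)], Finset.sum_const, nsmul_eq_mul]
  have hc : (Finset.univ.filter fun k => k ∈ targets μ x).card = (targets μ x).ncard := by
    rw [← Set.ncard_coe_finset]
    congr 1
    ext
    simp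
  rw [hc]
  have : z ≠ 0 := by linarith
  field_simp

lemma departure_lyapunov_le {μ : Fin M → ℝ} (hμ : ∀ j, 0 < μ j) {z : ℝ} (hz : 1 ≤ z)
    (x : State N) :
    (∑ k : Server N, if 0 < x k then
      μ k.1 * (lyapunov z (Function.update x k (x k - 1)) - lyapunov z x) else 0) ≤
      lyapunov z x * ((z - 1) * ∑ j ∈ fastTypes M, μ j * N j) := by
  have h0 : 0 ≤ lyapunov z x := pow_nonneg (by linarith) _
  have hterm : ∀ k : Server N, (if 0 < x k then
      μ k.1 * (lyapunov z (Function.update x k (x k - 1)) - lyapunov z x) else 0) ≤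
      if k.1 ∈ fastTypes M then μ k.1 * (lyapunov z x * (z - 1)) else 0 := by
    intro k
    have hk := pow_le_pow_right₀ hz (card_idleFast_update_pred_le x k)
    have hμk := (hμ k.1).le
    split_ifs with h1 h2 h2
    · refine mul_le_mul_of_nonneg_left ?_ hμk
      rw [if_pos h2, pow_succ] at hk
      simp only [lyapunov]
      linarith
    · refine mul_nonpos_of_nonneg_of_nonpos hμk (sub_nonpos.2 ?_)
      rwa [if_neg h2, add_zero] at hk
    · exact mul_nonneg hμk (mul_nonneg h0 (by linarith))
    · exact le_rfl
  refine (Finset.sum_le_sum fun k _ => hterm k).trans (le_of_eq ?_)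
  rw [Fintype.sum_sigma]
  simp only [Finset.sum_const, Finset.card_univ, Fintype.card_fin, nsmul_eq_mul, mul_ite, mul_zero]
  rw [Finset.sum_ite_mem, Finset.univ_inter, Finset.mul_sum, Finset.mul_sum]
  exact Finset.sum_congr rfl fun j _ => by ring

/-- The drift condition. -/
lemma generator_lyapunov_le {a : ℝ} (ha : 0 ≤ a) {μ : Fin M → ℝ} (hμ : StrictAnti μ)
    (hμ0 : ∀ j, 0 < μ j) {z : ℝ} (hz : 1 ≤ z) {c : ℝ} (hc : 0 ≤ c)
    (hdrift : (z - 1) * (∑ j ∈ fastTypes M, μ j * N j - a / z) ≤ -c) (x : State N) :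
    generator a μ N (lyapunov z) x ≤ -c * lyapunov z x + ((z - 1) * a + c) := by
  have h0 : 0 ≤ lyapunov z x := pow_nonneg (by linarith) _
  have hdep := departure_lyapunov_le hμ0 hz x
  have hz1 : 0 ≤ (z - 1) * a := mul_nonneg (by linarith) ha
  unfold generator
  -- With no idle fast server V = 1 and arrivals need not lower V; the missing term (z - 1)a/z is
  -- absorbed by the additive constant.
  rcases (idleFast x).eq_empty_or_nonempty with h | h
  · have h1 : lyapunov z x = 1 := by simp [lyapunov, h]
    have haz : a / z ≤ a := div_le_self ha hz
    have h2 : (z - 1) * (a / z) ≤ (z - 1) * a := mul_le_mul_of_nonneg_left haz (by linarith)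
    have := arrival_lyapunov_nonpos ha μ hz x
    refine (add_le_add this hdep).trans ?_
    rw [h1]
    linarith
  · rw [arrival_lyapunov_eq a hμ hz h]
    have := mul_le_mul_of_nonneg_left hdrift h0
    linarith

end Idle

/-! ### Tail bounds for a single system -/

section Asymptotics

lemma lyapunov_eq_exp {M : ℕ} {N : Fin M → ℕ} {z : ℝ} (hz : 0 < z) (x : State N) :
    lyapunov z x = Real.exp (Real.log z * (idleFast x).card) := by
  rw [lyapunov, mul_comm, Real.exp_nat_mul, Real.exp_log hz]

section Fixed

variable {M : ℕ} {N : Fin M → ℕ} {Ω : Type*} {mΩ : MeasurableSpace Ω} {P : Measure Ω}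
  [IsProbabilityMeasure P] {a : ℝ} {μ : Fin M → ℝ} {X : ℝ≥0 → Ω → State N}

lemma measure_exists_card_idleFast_le (hX : IsSAJSQ P a μ N X) (ha : 0 ≤ a) (hμ : StrictAnti μ)
    (hμ0 : ∀ j, 0 < μ j) {z : ℝ} (hz : 1 < z) {c C : ℝ} (hc : 0 ≤ c)
    (hdrift : (z - 1) * (∑ j ∈ fastTypes M, μ j * N j - a / z) ≤ -c) (hC : (z - 1) * a + c ≤ C)
    {s T : ℝ≥0} (hsT : s ≤ T) {p q : ℝ}
    (hpq : Real.exp (Real.log z * p) + C * T < Real.exp (Real.log z * q)) :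
    P {ω | ∃ u ∈ Set.Icc s T, q ≤ (idleFast (X u ω)).card} ≤
      P {ω | p < (idleFast (X s ω)).card} + ENNReal.ofReal
        ((Real.exp (Real.log z * p) + C * T) /
          (Real.exp (Real.log z * q) - (Real.exp (Real.log z * p) + C * T))) := by
  obtain ⟨hcad, ℱ, had, hmart⟩ := hX
  have hz0 : 0 < z := by linarith
  have hlog : 0 < Real.log z := Real.log_pos hz
  have hC0 : 0 ≤ C := le_trans (add_nonneg (mul_nonneg (by linarith) ha) hc) hC
  have hb : ∀ x : State N, |lyapunov z x| ≤ _ := abs_lyapunov_le hz.le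
  have := measure_exists_mem_Icc_le (P := P) hcad had
    (fun x : State N => show 0 ≤ lyapunov z x from pow_nonneg hz0.le _)
    (abs_generator_le a μ hb) (hmart _ ⟨_, hb⟩) hC0 (fun x => by
      have h1 := generator_lyapunov_le ha hμ hμ0 hz.le hc hdrift x
      have h2 : 0 ≤ c * lyapunov z x := mul_nonneg hc (pow_nonneg hz0.le _)
      linarith) hsT (Real.exp_pos (Real.log z * p)).le hpq
  simpa only [lyapunov_eq_exp hz0, Real.exp_le_exp, Real.exp_lt_exp, mul_le_mul_iff_right₀ hlog,
    mul_lt_mul_iff_right₀ hlog] using this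

/-- Markov's inequality for z^I at time t, restricted to {I(0) ≤ q}, where the initial value is at
most z^q. -/
lemma measure_card_idleFast_gt_le (hX : IsSAJSQ P a μ N X) (ha : 0 ≤ a) (hμ : StrictAnti μ)
    (hμ0 : ∀ j, 0 < μ j) {z : ℝ} (hz : 1 < z) {c C : ℝ} (hc : 0 < c)
    (hdrift : (z - 1) * (∑ j ∈ fastTypes M, μ j * N j - a / z) ≤ -c) (hC : (z - 1) * a + c ≤ C)
    (t : ℝ≥0) (p q : ℝ) :
    P {ω | p < (idleFast (X t ω)).card} ≤
      P {ω | q < (idleFast (X 0 ω)).card} + ENNReal.ofReal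
        ((Real.exp (-c * t) * Real.exp (Real.log z * q) + C / c) / Real.exp (Real.log z * p)) := by
  obtain ⟨hcad, ℱ, had, hmart⟩ := hX
  have hz0 : 0 < z := by linarith
  have hlog : 0 < Real.log z := Real.log_pos hz
  have hC0 : 0 ≤ C := le_trans (add_nonneg (mul_nonneg (by linarith) ha) hc.le) hC
  have hb : ∀ x : State N, |lyapunov z x| ≤ _ := abs_lyapunov_le hz.le
  set A : Set Ω := {ω | ((idleFast (X 0 ω)).card : ℝ) ≤ q} with hA
  have hAm : MeasurableSet[ℱ 0] A :=
    had 0 (MeasurableSet.of_discrete (s := {x : State N | ((idleFast x).card : ℝ) ≤ q}))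
  have hdec := setIntegral_le_of_generator_le (P := P) hcad had hb (abs_generator_le a μ hb)
    (hmart _ ⟨_, hb⟩) hc hC0
    (fun x => (generator_lyapunov_le ha hμ hμ0 hz.le hc.le hdrift x).trans
      (add_le_add le_rfl hC)) t hAm
  have hinit : ∫ ω in A, lyapunov z (X 0 ω) ∂P ≤ Real.exp (Real.log z * q) := by
    have h1 := norm_setIntegral_le_of_norm_le_const (μ := P) (s := A)
      (f := fun ω => lyapunov z (X 0 ω)) (C := Real.exp (Real.log z * q)) (measure_lt_top _ _)
      (fun ω hω => by
        rw [lyapunov_eq_exp hz0, Real.norm_of_nonneg (Real.exp_pos _).le]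
        exact Real.exp_le_exp.2 (mul_le_mul_of_nonneg_left hω hlog.le))
    exact (le_abs_self _).trans (h1.trans (mul_le_of_le_one_right (Real.exp_pos _).le
      measureReal_le_one))
  set u := Real.exp (Real.log z * p) with hu
  have hu0 : 0 < u := Real.exp_pos _
  have hmarkov := mul_meas_ge_le_integral_of_nonneg (μ := P.restrict A)
    (f := fun ω => lyapunov z (X t ω)) (Eventually.of_forall fun ω => pow_nonneg hz0.le _)
    (integrable_comp had hb t).integrableOn u
  have hreal : (P.restrict A).real {ω | u ≤ lyapunov z (X t ω)} ≤
      (Real.exp (-c * t) * Real.exp (Real.log z * q) + C / c) / u := by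
    rw [le_div_iff₀ hu0, mul_comm]
    refine hmarkov.trans (hdec.trans ?_)
    gcongr
  have hsub : {ω | p < (idleFast (X t ω)).card} ⊆
      {ω | q < (idleFast (X 0 ω)).card} ∪ ({ω | u ≤ lyapunov z (X t ω)} ∩ A) := by
    intro ω hω
    have hω : p < (idleFast (X t ω)).card := hω
    by_cases h : q < (idleFast (X 0 ω)).card
    · exact Or.inl h
    · refine Or.inr ⟨?_, not_lt.1 h⟩
      rw [Set.mem_ofPred_eq, lyapunov_eq_exp hz0]
      exact Real.exp_le_exp.2 (mul_le_mul_of_nonneg_left hω.le hlog.le)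
  refine (measure_mono hsub).trans ((measure_union_le _ _).trans (add_le_add le_rfl ?_))
  rw [← Measure.restrict_apply' (ℱ.le 0 _ hAm)]
  exact (ENNReal.le_ofReal_iff_toReal_le (measure_ne_top _ _)
    (le_trans measureReal_nonneg hreal)).2 hreal

end Fixed

/-! ### Exponentials in √n, and tails of weak limits -/

lemma tendsto_exp_mul_sqrt {θ : ℝ} (hθ : 0 < θ) :
    Tendsto (fun n : ℕ => Real.exp (θ * √(n : ℝ))) atTop atTop :=
  Real.tendsto_exp_atTop.comp ((Real.tendsto_sqrt_atTop.comp
    tendsto_natCast_atTop_atTop).const_mul_atTop hθ)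

lemma eventually_mul_le_exp_mul_sqrt {θ : ℝ} (hθ : 0 < θ) (K : ℝ) :
    ∀ᶠ n : ℕ in atTop, K * n ≤ Real.exp (θ * √(n : ℝ)) := by
  have h1 : Tendsto (fun n : ℕ => θ * √(n : ℝ)) atTop atTop :=
    (Real.tendsto_sqrt_atTop.comp tendsto_natCast_atTop_atTop).const_mul_atTop hθ
  filter_upwards [((Real.tendsto_exp_div_pow_atTop 2).comp h1).eventually_ge_atTop (K / θ ^ 2),
    eventually_gt_atTop 0] with n hn hn0
  have hn0 : (0 : ℝ) < n := by exact_mod_cast hn0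
  simp only [Function.comp] at hn
  rw [mul_pow, Real.sq_sqrt hn0.le, div_le_div_iff₀ (by positivity) (by positivity)] at hn
  have h2 : (K * n) * θ ^ 2 ≤ Real.exp (θ * √(n : ℝ)) * θ ^ 2 := by linarith
  exact le_of_mul_le_mul_right h2 (by positivity)

lemma eventually_mul_sqrt_le {t : ℝ} (ht : 0 < t) (L : ℝ) :
    ∀ᶠ n : ℕ in atTop, L * √(n : ℝ) ≤ t * n := by
  filter_upwards [(Real.tendsto_sqrt_atTop.comp tendsto_natCast_atTop_atTop).eventually_ge_atTop
    (L / t)] with n hn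
  have hn : L / t ≤ √(n : ℝ) := hn
  rw [div_le_iff₀ ht] at hn
  calc L * √(n : ℝ) ≤ √(n : ℝ) * t * √(n : ℝ) := by gcongr
    _ = t * n := by rw [mul_right_comm, Real.mul_self_sqrt (Nat.cast_nonneg n), mul_comm]

/-- With u = exp(θδ√n), the bound is (u + Kn)/(u² - (u + Kn)). Eventually Kn ≤ u and u ≥ 4, which
makes it at most 4/u. -/
lemma tendsto_maximal_bound {θ δ : ℝ} (hθ : 0 < θ) (hδ : 0 < δ) (K : ℝ) :
    (∀ᶠ n : ℕ in atTop, Real.exp (θ * (δ * √(n : ℝ))) + K * n <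
      Real.exp (θ * (2 * δ * √(n : ℝ)))) ∧
    Tendsto (fun n : ℕ => ENNReal.ofReal ((Real.exp (θ * (δ * √(n : ℝ))) + K * n) /
      (Real.exp (θ * (2 * δ * √(n : ℝ))) - (Real.exp (θ * (δ * √(n : ℝ))) + K * n))))
      atTop (𝓝 0) := by
  set u : ℕ → ℝ := fun n => Real.exp (θ * (δ * √(n : ℝ))) with hu
  have hutop : Tendsto u atTop atTop := by
    simpa only [hu, ← mul_assoc] using tendsto_exp_mul_sqrt (mul_pos hθ hδ)
  have hsq : ∀ n : ℕ, Real.exp (θ * (2 * δ * √(n : ℝ))) = u n ^ 2 := by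
    intro n
    rw [hu, ← Real.exp_nat_mul]
    congr 1
    push_cast
    ring
  have hev : ∀ᶠ n in atTop, 4 ≤ u n ∧ K * n ≤ u n := by
    refine (hutop.eventually_ge_atTop 4).and ?_
    simpa only [hu, ← mul_assoc] using eventually_mul_le_exp_mul_sqrt (mul_pos hθ hδ) K
  simp only [hsq]
  refine ⟨hev.mono fun n hn => by nlinarith, ?_⟩
  have h4 : Tendsto (fun n => ENNReal.ofReal (4 / u n)) atTop (𝓝 0) := by
    have := (ENNReal.continuous_ofReal.tendsto 0).comp (hutop.const_div_atTop 4)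
    rwa [ENNReal.ofReal_zero] at this
  refine tendsto_of_tendsto_of_tendsto_of_le_of_le' tendsto_const_nhds h4
    (Eventually.of_forall fun _ => zero_le) (hev.mono fun n hn => ENNReal.ofReal_le_ofReal ?_)
  obtain ⟨h1, h2⟩ := hn
  have h0 : 0 < u n := by linarith
  rw [div_le_div_iff₀ (by nlinarith) h0]
  nlinarith

/-- The exponent -cnt beats θL√n, so the numerator is eventually at most 1 + C/c. -/
lemma tendsto_decay_bound {θ δ c C t : ℝ} (hθ : 0 < θ) (hδ : 0 < δ) (hc : 0 < c) (ht : 0 < t)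
    (L : ℝ) :
    Tendsto (fun n : ℕ => ENNReal.ofReal ((Real.exp (-(c * n) * t) *
      Real.exp (θ * (L * √(n : ℝ))) + C * n / (c * n)) / Real.exp (θ * (δ * √(n : ℝ)))))
      atTop (𝓝 0) := by
  have hutop : Tendsto (fun n : ℕ => Real.exp (θ * (δ * √(n : ℝ)))) atTop atTop := by
    simpa only [← mul_assoc] using tendsto_exp_mul_sqrt (mul_pos hθ hδ)
  have h4 := (ENNReal.continuous_ofReal.tendsto 0).comp (hutop.const_div_atTop (1 + C / c))
  rw [ENNReal.ofReal_zero] at h4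
  refine tendsto_of_tendsto_of_tendsto_of_le_of_le' tendsto_const_nhds h4
    (Eventually.of_forall fun _ => zero_le) ?_
  filter_upwards [eventually_mul_sqrt_le (mul_pos hc ht) (θ * L), eventually_gt_atTop 0]
    with n hn hn0
  have hn0 : (n : ℝ) ≠ 0 := by exact_mod_cast hn0.ne'
  refine ENNReal.ofReal_le_ofReal ?_
  rw [mul_div_mul_right _ _ hn0, ← Real.exp_add]
  refine div_le_div_of_nonneg_right (add_le_add_left (Real.exp_le_one_iff.2 ?_) _)
    (Real.exp_pos _).le
  linarith

/-- Portmanteau theorem for the closed set {L ≤ |y|}. -/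
lemma eventually_measure_lt {Ω : ℕ → Type*} {mΩ : ∀ n, MeasurableSpace (Ω n)}
    {P : ∀ n, Measure (Ω n)} [∀ n, IsProbabilityMeasure (P n)] {Ω' : Type*}
    {mΩ' : MeasurableSpace Ω'} {P' : Measure Ω'} [IsProbabilityMeasure P'] {Y : ∀ n, Ω n → ℝ}
    {Z : Ω' → ℝ} (h : TendstoInDistribution Y atTop Z P P') (L : ℝ) {η : ENNReal}
    (hη : P'.map Z {y | L ≤ |y|} < η) : ∀ᶠ n in atTop, P n {ω | L ≤ |Y n ω|} < η := by
  have hcl : IsClosed {y : ℝ | L ≤ |y|} := isClosed_le continuous_const continuous_abs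
  have h1 := ProbabilityMeasure.limsup_measure_closed_le_of_tendsto h.tendsto hcl
  refine (eventually_lt_of_limsup_lt (h1.trans_lt hη)).mono fun n hn => ?_
  rwa [ProbabilityMeasure.coe_mk,
    Measure.map_apply_of_aemeasurable (h.forall_aemeasurable n) hcl.measurableSet] at hn

lemma exists_measure_abs_ge_lt (ν : Measure ℝ) [IsFiniteMeasure ν] {η : ENNReal} (hη : 0 < η) :
    ∃ L : ℝ, ν {y | L ≤ |y|} < η := by
  have h1 : Tendsto (fun n : ℕ => ν {y : ℝ | (n : ℝ) ≤ |y|}) atTop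
      (𝓝 (ν (⋂ n : ℕ, {y : ℝ | (n : ℝ) ≤ |y|}))) :=
    tendsto_measure_iInter_atTop
      (fun n => (isClosed_le continuous_const continuous_abs).measurableSet.nullMeasurableSet)
      (fun m n hmn y hy => le_trans (Nat.cast_le.2 hmn) (show (n : ℝ) ≤ |y| from hy))
      ⟨0, measure_ne_top _ _⟩
  have h2 : (⋂ n : ℕ, {y : ℝ | (n : ℝ) ≤ |y|}) = ∅ := by
    refine Set.eq_empty_of_forall_notMem fun y hy => ?_
    obtain ⟨n, hn⟩ := exists_nat_gt |y|
    exact absurd (Set.mem_iInter.1 hy n) (not_le.2 hn)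
  rw [h2, measure_empty] at h1
  obtain ⟨n, hn⟩ := (h1.eventually_lt_const hη).exists
  exact ⟨n, hn⟩

/-! ### The sequence of systems -/

section Sequence

variable {M : ℕ} {μ γ : Fin M → ℝ} {lam : ℕ → ℝ} {N : ℕ → Fin M → ℕ}

lemma exists_drift {β : ℝ} (hμ_pos : ∀ j, 0 < μ j) (hγ_pos : ∀ j, 0 < γ j)
    (hcap : ∑ j, μ j * γ j = 1)
    (hA1 : Tendsto (fun n : ℕ => √(n : ℝ) * (1 - lam n)) atTop (𝓝 β))
    (hA2 : ∀ j, Tendsto (fun n : ℕ => √(n : ℝ) * |(N n j : ℝ) / (n : ℝ) - γ j|) atTop (𝓝 0)) :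
    ∃ z c : ℝ, 1 < z ∧ 0 < c ∧ ∀ᶠ n : ℕ in atTop,
      (z - 1) * (∑ j ∈ fastTypes M, μ j * N n j - n * lam n / z) ≤ -(c * n) := by
  have hsqrt : Tendsto (fun n : ℕ => (√(n : ℝ))⁻¹) atTop (𝓝 0) :=
    tendsto_inv_atTop_zero.comp (Real.tendsto_sqrt_atTop.comp tendsto_natCast_atTop_atTop)
  have hcancel : ∀ {g : ℕ → ℝ} {l : ℝ}, Tendsto (fun n : ℕ => √(n : ℝ) * g n) atTop (𝓝 l) →
      Tendsto g atTop (𝓝 0) := by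
    intro g l h
    have := hsqrt.mul h
    rw [zero_mul] at this
    refine this.congr' ?_
    filter_upwards [eventually_gt_atTop 0] with n hn
    rw [inv_mul_cancel_left₀ (by positivity)]
  have hlam : Tendsto lam atTop (𝓝 1) := by
    simpa using (hcancel hA1).const_sub 1
  have hN : ∀ j, Tendsto (fun n : ℕ => (N n j : ℝ) / n) atTop (𝓝 (γ j)) := fun j => by
    simpa using ((tendsto_zero_iff_abs_tendsto_zero _).2 (hcancel (hA2 j))).add_const (γ j)
  set S := ∑ j ∈ fastTypes M, μ j * γ j with hS
  have hM : 0 < M := by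
    rcases Nat.eq_zero_or_pos M with rfl | h
    · simp at hcap
    · exact h
  -- The slowest type has index M - 1, lies outside `fastTypes M` and contributes a positive term.
  have hS1 : S < 1 := by
    rw [← hcap]
    refine Finset.sum_lt_sum_of_subset (Finset.subset_univ _)
      (Finset.mem_univ (⟨M - 1, by omega⟩ : Fin M)) ?_ (mul_pos (hμ_pos _) (hγ_pos _))
      fun j _ _ => (mul_pos (hμ_pos j) (hγ_pos j)).le
    simp only [fastTypes, Finset.mem_filter, Finset.mem_univ, true_and]
    omega
  -- With z = 1 + κ the limiting drift is negative: S - 1/z < 0 means z < 1/(1 - κ). The constant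
  -- `c` below is half of the limiting rate κ³/(1 + κ).
  set κ := 1 - S with hκ
  have hκ0 : 0 < κ := by linarith
  have hlim : Tendsto (fun n : ℕ => κ * (∑ j ∈ fastTypes M, μ j * ((N n j : ℝ) / n) -
      lam n / (1 + κ))) atTop (𝓝 (κ * (S - 1 / (1 + κ)))) :=
    ((tendsto_finsetSum _ fun j _ => (hN j).const_mul _).sub (hlam.div_const _)).const_mul _
  have hneg : κ * (S - 1 / (1 + κ)) = -(κ ^ 3 / (1 + κ)) := by
    have : S = 1 - κ := by rw [hκ]; ring
    rw [this]
    field_simp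
    ring
  refine ⟨1 + κ, κ ^ 3 / (1 + κ) / 2, by linarith, by positivity, ?_⟩
  have hpos : 0 < κ ^ 3 / (1 + κ) := by positivity
  filter_upwards [hlim.eventually_le_const (u := -(κ ^ 3 / (1 + κ) / 2)) (by rw [hneg]; linarith),
    eventually_gt_atTop 0] with n hn hn0
  have hn0 : (0 : ℝ) < n := by exact_mod_cast hn0
  have h1 := mul_le_mul_of_nonneg_right hn hn0.le
  have h2 : ∑ j ∈ fastTypes M, μ j * ((N n j : ℝ) / n) =
      (∑ j ∈ fastTypes M, μ j * N n j) / n := by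
    rw [Finset.sum_div]
    exact Finset.sum_congr rfl fun j _ => by rw [mul_div_assoc]
  rw [h2] at h1
  rw [add_sub_cancel_left, ← neg_mul]
  refine le_trans (le_of_eq ?_) h1
  field_simp

variable {Ω : ℕ → Type*} {mΩ : ∀ n, MeasurableSpace (Ω n)} {P : ∀ n, Measure (Ω n)}
  [∀ n, IsProbabilityMeasure (P n)] {X : ∀ n, ℝ≥0 → Ω n → State (N n)} {z c : ℝ}

lemma rate_le (hlam_lt : ∀ n, lam n < 1) (hz : 1 < z) (n : ℕ) :
    (z - 1) * (n * lam n) + c * n ≤ (z - 1 + c) * n := by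
  rw [add_mul]
  have := mul_le_of_le_one_right (Nat.cast_nonneg (α := ℝ) n) (hlam_lt n).le
  exact add_le_add_left (mul_le_mul_of_nonneg_left this (by linarith)) _

lemma tendsto_measure_iSup (hμ0 : ∀ j, 0 < μ j) (hμ : StrictAnti μ) (hlam_nonneg : ∀ n, 0 ≤ lam n)
    (hlam_lt : ∀ n, lam n < 1) (hX : ∀ n, IsSAJSQ (P n) ((n : ℝ) * lam n) μ (N n) (X n))
    (hz : 1 < z) (hc : 0 < c) (hdrift : ∀ᶠ n : ℕ in atTop,
      (z - 1) * (∑ j ∈ fastTypes M, μ j * N n j - n * lam n / z) ≤ -(c * n))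
    {s T : ℝ≥0} (hsT : s ≤ T)
    (hs : ∀ δ : ℝ, 0 < δ → Tendsto (fun n : ℕ => P n {ω | δ * √(n : ℝ) < (idleFast (X n s ω)).card})
      atTop (𝓝 0)) {ε : ℝ} (hε : 0 < ε) :
    Tendsto (fun n => P n {ω | ε < ⨆ u : Set.Icc s T, |scaledBlock n (X n u ω) 1 (M - 1) 1|})
      atTop (𝓝 0) := by
  -- Confinement goes from level δ√n to level 2δ√n, which is to be ε√n.
  have hδ : 0 < ε / 2 := by linarith
  obtain ⟨h1, h2⟩ := tendsto_maximal_bound (Real.log_pos hz) hδ ((z - 1 + c) * T)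
  have h3 := (hs _ hδ).add h2
  rw [add_zero] at h3
  refine tendsto_of_tendsto_of_tendsto_of_le_of_le' tendsto_const_nhds h3
    (Eventually.of_forall fun _ => zero_le) ?_
  filter_upwards [h1, hdrift, eventually_gt_atTop 0] with n hn hd hn0
  have hsq : 0 < √(n : ℝ) := Real.sqrt_pos.2 (by exact_mod_cast hn0)
  have hcomm : (z - 1 + c) * T * n = (z - 1 + c) * n * T := by ring
  rw [hcomm] at hn ⊢
  have hmax := measure_exists_card_idleFast_le (hX n)
    (mul_nonneg (Nat.cast_nonneg n) (hlam_nonneg n)) hμ hμ0 hz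
    (mul_nonneg hc.le (Nat.cast_nonneg n)) hd (rate_le hlam_lt hz n) hsT hn
  refine (measure_mono fun ω hω => ?_).trans hmax
  -- If no term exceeded ε, neither would the supremum over this nonempty index set; no boundedness
  -- of the path is needed.
  have : Nonempty (Set.Icc s T) := ⟨⟨s, le_rfl, hsT⟩⟩
  have hω : ε < ⨆ u : Set.Icc s T, |scaledBlock n (X n u ω) 1 (M - 1) 1| := hω
  obtain ⟨u, hu⟩ := exists_lt_of_lt_ciSup hω
  refine ⟨u, u.2, ?_⟩
  rw [scaledBlock_eq, abs_div, abs_neg, Nat.abs_cast, abs_of_pos hsq, lt_div_iff₀ hsq] at hu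
  linarith

omit [∀ n, IsProbabilityMeasure (P n)] in
lemma measure_card_idleFast_zero_le {n : ℕ} (hn : 0 < n) (L : ℝ) :
    P n {ω | L * √(n : ℝ) < (idleFast (X n 0 ω)).card} ≤
      P n {ω | L ≤ |scaledBlock n (X n 0 ω) 1 (M - 1) 1|} := by
  refine measure_mono fun ω hω => ?_
  have hsq : 0 < √(n : ℝ) := Real.sqrt_pos.2 (by exact_mod_cast hn)
  rw [Set.mem_ofPred_eq, scaledBlock_eq, abs_div, abs_neg, Nat.abs_cast, abs_of_pos hsq,
    le_div_iff₀ hsq]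
  exact le_of_lt hω

variable {Ω' : Type*} {mΩ' : MeasurableSpace Ω'} {P' : Measure Ω'} [IsProbabilityMeasure P']

lemma tendsto_measure_card_idleFast_gt (hμ0 : ∀ j, 0 < μ j) (hμ : StrictAnti μ)
    (hlam_nonneg : ∀ n, 0 ≤ lam n)
    (hlam_lt : ∀ n, lam n < 1) (hX : ∀ n, IsSAJSQ (P n) ((n : ℝ) * lam n) μ (N n) (X n))
    (hz : 1 < z) (hc : 0 < c) (hdrift : ∀ᶠ n : ℕ in atTop,
      (z - 1) * (∑ j ∈ fastTypes M, μ j * N n j - n * lam n / z) ≤ -(c * n))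
    {Z : Ω' → ℝ} (hZ : TendstoInDistribution
      (fun n ω => scaledBlock n (X n 0 ω) 1 (M - 1) 1) atTop Z P P')
    {t : ℝ≥0} (ht : 0 < t) {δ : ℝ} (hδ : 0 < δ) :
    Tendsto (fun n : ℕ => P n {ω | δ * √(n : ℝ) < (idleFast (X n t ω)).card}) atTop (𝓝 0) := by
  refine ENNReal.tendsto_nhds_zero.2 fun η hη => ?_
  have hη2 : 0 < η / 2 := ENNReal.half_pos hη.ne'
  have : IsProbabilityMeasure (P'.map Z) := Measure.isProbabilityMeasure_map hZ.aemeasurable_limit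
  -- Half of η pays for initial values beyond L√n, the other half for failure of the decay from
  -- below that level.
  obtain ⟨L, hL⟩ := exists_measure_abs_ge_lt (P'.map Z) hη2
  have hdecay := tendsto_decay_bound (C := z - 1 + c) (Real.log_pos hz) hδ hc
    (NNReal.coe_pos.2 ht) L
  filter_upwards [eventually_measure_lt hZ L hL, hdecay.eventually_lt_const hη2, hdrift,
    eventually_gt_atTop 0] with n h1 h2 hd hn
  have h3 := measure_card_idleFast_gt_le (hX n) (mul_nonneg (Nat.cast_nonneg n) (hlam_nonneg n))
    hμ hμ0 hz (mul_pos hc (by exact_mod_cast hn)) hd (rate_le hlam_lt hz n) t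
    (δ * √(n : ℝ)) (L * √(n : ℝ))
  calc _ ≤ _ := h3
    _ ≤ η / 2 + η / 2 := add_le_add ((measure_card_idleFast_zero_le hn L).trans h1.le) h2.le
    _ = η := ENNReal.add_halves η

lemma tendsto_measure_card_idleFast_zero_gt (hZ : TendstoInDistribution
      (fun n ω => scaledBlock n (X n 0 ω) 1 (M - 1) 1) atTop (fun _ : Ω' => (0 : ℝ)) P P')
    {δ : ℝ} (hδ : 0 < δ) :
    Tendsto (fun n : ℕ => P n {ω | δ * √(n : ℝ) < (idleFast (X n 0 ω)).card}) atTop (𝓝 0) := by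
  refine ENNReal.tendsto_nhds_zero.2 fun η hη => ?_
  have h0 : P'.map (fun _ => (0 : ℝ)) {y | δ ≤ |y|} < η := by
    rw [Measure.map_apply measurable_const
      (isClosed_le continuous_const continuous_abs).measurableSet]
    simpa [hδ.not_ge] using hη
  filter_upwards [eventually_measure_lt hZ δ h0, eventually_gt_atTop 0] with n h1 hn
  exact (measure_card_idleFast_zero_le hn δ).trans h1.le

end Sequence

end Asymptotics

end SAJSQ

theorem mainTheorem6
    -- server types, in order of decreasing speed, with the limiting proportions
    {M : ℕ} (μ γ : Fin M → ℝ) (β : ℝ) (hβ : 0 < β)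
    (hμ_pos : ∀ j, 0 < μ j) (hμ_anti : StrictAnti μ)
    (hγ_pos : ∀ j, 0 < γ j) (hcap : ∑ j, μ j * γ j = 1)
    -- arrival rate per server and pool sizes of the `n`-th system
    (lam : ℕ → ℝ) (hlam_nonneg : ∀ n, 0 ≤ lam n) (hlam_lt : ∀ n, lam n < 1)
    (N : ℕ → Fin M → ℕ) (hN : ∀ n, ∑ j, N n j = n)
    -- (A1) and (A2)
    (hA1 : Tendsto (fun n : ℕ => √(n : ℝ) * (1 - lam n)) atTop (𝓝 β))
    (hA2 : ∀ j, Tendsto (fun n : ℕ => √(n : ℝ) * |(N n j : ℝ) / (n : ℝ) - γ j|) atTop (𝓝 0))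
    -- the systems under the SA-JSQ policy
    {Ω : ℕ → Type*} {mΩ : ∀ n, MeasurableSpace (Ω n)}
    (P : ∀ n, Measure (Ω n)) [∀ n, IsProbabilityMeasure (P n)]
    (X : ∀ n, ℝ≥0 → Ω n → SAJSQ.State (N n))
    (hX : ∀ n, SAJSQ.IsSAJSQ (P n) ((n : ℝ) * lam n) μ (N n) (X n))
    -- the space on which the limit of the initial values is defined
    {Ω' : Type*} {mΩ' : MeasurableSpace Ω'} (P' : Measure Ω') [IsProbabilityMeasure P'] :
    (∀ Z : Ω' → ℝ,
      TendstoInDistribution (fun n ω => SAJSQ.scaledBlock n (X n 0 ω) 1 (M - 1) 1) atTop Z P P' →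
      ∀ ε : ℝ, 0 < ε → ∀ t₀ T : ℝ≥0, 0 < t₀ → t₀ ≤ T →
        Tendsto (fun n => P n {ω | ε < ⨆ s : Set.Icc t₀ T,
          |SAJSQ.scaledBlock n (X n s ω) 1 (M - 1) 1|}) atTop (𝓝 0)) ∧
    (TendstoInDistribution (fun n ω => SAJSQ.scaledBlock n (X n 0 ω) 1 (M - 1) 1) atTop
        (fun _ : Ω' => (0 : ℝ)) P P' →
      ∀ ε : ℝ, 0 < ε → ∀ T : ℝ≥0,
        Tendsto (fun n => P n {ω | ε < ⨆ s : Set.Icc (0 : ℝ≥0) T,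
          |SAJSQ.scaledBlock n (X n s ω) 1 (M - 1) 1|}) atTop (𝓝 0)) := by
  obtain ⟨z, c, hz, hc, hdrift⟩ := SAJSQ.exists_drift hμ_pos hγ_pos hcap hA1 hA2
  exact ⟨fun Z hZ ε hε t₀ T ht₀ hT =>
      SAJSQ.tendsto_measure_iSup hμ_pos hμ_anti hlam_nonneg hlam_lt hX hz hc hdrift hT
        (fun δ hδ => SAJSQ.tendsto_measure_card_idleFast_gt hμ_pos hμ_anti hlam_nonneg hlam_lt hX
          hz hc hdrift hZ ht₀ hδ) hε,
    fun hZ ε hε T =>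
      SAJSQ.tendsto_measure_iSup hμ_pos hμ_anti hlam_nonneg hlam_lt hX hz hc hdrift zero_le
        (fun δ hδ => SAJSQ.tendsto_measure_card_idleFast_zero_gt hZ hδ) hε⟩
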